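/- Let $V$ be a finite nonempty metric space with $n$ points and let $k\ge 1$ be an integer. For $T\subseteq V$ put $\mathrm{cost}(T)=\max_{x\in V}d(x,T)$ (with $d(x,\varnothing)=\infty$). For $S\subseteq V$ let $\mathrm{OPT}(V,S)=\min\{\mathrm{cost}(T): T\subseteq S,\ |T|\le k\}$ be the optimal $k$-center cost of covering $V$ with centers from $S$ (it is $\infty$ if $S=\varnothing$), and let $\mathrm{OPT}=\mathrm{OPT}(V,V)$. For $\varepsilon,\varphi>0$ consider the following sampling procedure ($\log$ is the natural logarithm, and probabilities are capped at $1$). Start with $S=\varnothing$, $R=V$. While $|R|>(4/\varepsilon)\,k\,n^{\varepsilon}\log n$: independently, put each point of $R$ into a set $A$ with probability $9kn^{\varepsilon}(\log n)/|R|$ and into a set $H$ with probability $4n^{\varepsilon}(\log n)/|R|$; replace $S$ by $S\cup A$; let $v$ be the point in position $\lceil\varphi\log n\rceil$ when $H$ is ordered by distance to $S$ from farthest to nearest; remove from $R$ every point of $S$ and every $x$ with $d(x,S)\le d(v,S)$ (if $H$ has fewer than $\lceil\varphi\log n\rceil$ points, only the points of $S$ are removed). When the loop ends, return $C=S\cup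 R$. Then for all $\varepsilon,\varphi>0$ there is a constant $K$, depending only on $\varepsilon$ and $\varphi$, such that for every $\gamma>0$ satisfying, with $x=1+\gamma$, $$\frac{\varphi+x+\sqrt{2x\varphi+x^2}}{5}\ \le\ \varphi+\frac x2-\sqrt{2x\varphi+\frac{x^2}{4}},$$ and for all $V$ and $k$ as above, with probability at least $1-K\,n^{-(1+\gamma)}$ the procedure terminates and the returned sample $C$ satisfies $$\mathrm{OPT}(V,C)\le 5\cdot \mathrm{OPT}.$$ -/

import Mathlib

open scoped ENNReal

noncomputable section

/-- The covering radius of the centre set `T`: the largest distance of a point of `V` to `T`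
(it is `⊤` if `T` is empty and `V` is not). -/
def coverCost {V : Type*} [MetricSpace V] (T : Finset V) : ℝ≥0∞ :=
  ⨆ x : V, Metric.infEDist x (T : Set V)

/-- `OPT(V, S)`: the optimal `k`-centre cost of covering all of `V` when the at most `k`
centres have to be chosen from `S`. -/
def optFrom {V : Type*} [MetricSpace V] (k : ℕ) (S : Finset V) : ℝ≥0∞ :=
  ⨅ (T : Finset V) (_ : T ⊆ S) (_ : T.card ≤ k), coverCost T

/-- `OPT`: the optimal `k`-centre cost of `V`. -/
def optCost (V : Type*) [MetricSpace V] [Fintype V] (k : ℕ) : ℝ≥0∞ :=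
  optFrom k (Finset.univ : Finset V)

/-- The random subset of `R` that contains each point of `R` independently with
probability `p`. -/
def bernoulliSubset {V : Type*} [DecidableEq V] (R : Finset V) (p : ℝ≥0∞) (hp : p ≤ 1) :
    PMF (Finset V) :=
  PMF.ofFinset
    (fun T => if T ⊆ R then p ^ T.card * (1 - p) ^ (R.card - T.card) else 0)
    R.powerset
    (by
      have h1 : ∀ T ∈ R.powerset,
          (if T ⊆ R then p ^ T.card * (1 - p) ^ (R.card - T.card) else 0)
            = p ^ T.card * (1 - p) ^ (R.card - T.card) := fun T hT =>
        if_pos (Finset.mem_powerset.mp hT)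
      rw [Finset.sum_congr rfl h1, Finset.sum_pow_mul_eq_add_pow,
        add_tsub_cancel_of_le hp, one_pow])
    (fun T hT => if_neg fun h => hT (Finset.mem_powerset.mpr h))

/-- The current sample `S` and the set `R` of points that are not yet represented. -/
structure EIMState (V : Type*) where
  S : Finset V
  R : Finset V

/-- `v` can stand in position `m` (counted from `1`) when the points of `H` are ordered by their
distance to `S` from farthest to nearest, ties being broken arbitrarily. -/
def IsPivot {V : Type*} [MetricSpace V] (H S : Finset V) (m : ℕ) (v : V) : Prop :=
  v ∈ H ∧
  {h ∈ (H : Set V) | Metric.infEDist v (S : Set V) < Metric.infEDist h (S : Set V)}.ncard < m ∧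
  m ≤ {h ∈ (H : Set V) | Metric.infEDist v (S : Set V) ≤ Metric.infEDist h (S : Set V)}.ncard

/-- The points that are still unrepresented after an iteration with pivot sample `H` and updated
sample `S`: a point of `R` is removed if it is in `S`, or if it is at most as far from `S` as the
pivot `v = Select(H, S)`, the point of `H` in position `⌈φ log n⌉`.
(If `H` has fewer points than that, there is no pivot.) -/
def remaining {V : Type*} [MetricSpace V] [Fintype V] (φ : ℝ) (R H S : Finset V) : Finset V :=
  open scoped Classical in
  R.filter fun x => ¬ (x ∈ S ∨
    ∃ v, IsPivot H S ⌈φ * Real.log (Fintype.card V)⌉₊ v ∧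
      Metric.infEDist x (S : Set V) ≤ Metric.infEDist v (S : Set V))

/-- The loop is left as soon as `|R| ≤ (4/ε) k n^ε log n`. -/
def Halted {V : Type*} [Fintype V] (k : ℕ) (ε : ℝ) (s : EIMState V) : Prop :=
  (s.R.card : ℝ) ≤ 4 / ε * k * (Fintype.card V : ℝ) ^ ε * Real.log (Fintype.card V)

/-- The probability `9 k n^ε (log n) / |R|` of adding a point of `R` to the sample,
capped at `1`. -/
def sampleProb {V : Type*} [Fintype V] (k : ℕ) (ε : ℝ) (R : Finset V) : ℝ≥0∞ :=
  min 1 (ENNReal.ofReal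
    (9 * k * (Fintype.card V : ℝ) ^ ε * Real.log (Fintype.card V) / R.card))

/-- The probability `4 n^ε (log n) / |R|` of adding a point of `R` to the pivot sample,
capped at `1`. -/
def pivotProb {V : Type*} [Fintype V] (ε : ℝ) (R : Finset V) : ℝ≥0∞ :=
  min 1 (ENNReal.ofReal
    (4 * (Fintype.card V : ℝ) ^ ε * Real.log (Fintype.card V) / R.card))

/-- One iteration of the sampling loop; a state in which the loop has been left is kept. -/
def eimStep {V : Type*} [MetricSpace V] [Fintype V] [DecidableEq V] (k : ℕ) (ε φ : ℝ)
    (s : EIMState V) : PMF (EIMState V) :=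
  open scoped Classical in
  if Halted k ε s then PMF.pure s
  else
    (bernoulliSubset s.R (sampleProb k ε s.R) (min_le_left _ _)).bind fun A =>
    (bernoulliSubset s.R (pivotProb ε s.R) (min_le_left _ _)).bind fun H =>
      PMF.pure ⟨s.S ∪ A, remaining φ s.R H (s.S ∪ A)⟩

/-- The distribution of the state after `t` iterations, started from `S = ∅` and `R = V`. -/
def eimRun (V : Type*) [MetricSpace V] [Fintype V] [DecidableEq V] (k : ℕ) (ε φ : ℝ) :
    ℕ → PMF (EIMState V)
  | 0 => PMF.pure ⟨∅, Finset.univ⟩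
  | t + 1 => (eimRun V k ε φ t).bind (eimStep k ε φ)

/-- The probability that the sampling procedure terminates and that the set `S ∪ R` which it
returns belongs to `E`. As states in which the loop has been left are kept, the probability of
having terminated with such an output within `t` iterations is nondecreasing in `t`, and its
supremum is the probability of ever doing so. -/
def eimProb (V : Type*) [MetricSpace V] [Fintype V] [DecidableEq V] (k : ℕ) (ε φ : ℝ)
    (E : Set (Finset V)) : ℝ≥0∞ :=
  ⨆ t : ℕ, (eimRun V k ε φ t).toOuterMeasure {s | Halted k ε s ∧ s.S ∪ s.R ∈ E}

end

/-! ### Probability bounds -/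

/-! Write N = |V| and x = 1 + γ, and fix optimal clusters of radius OPT. Outside an event of
probability at most 3 N^(-x), one iteration keeps every removed point within 2 OPT of the sample and
shrinks R by a factor N^(ε/2): - A meets every cluster holding a θ = (1 + x)/(9 k N^ε) fraction of R
(`sampleProb_miss_cluster_le`), so at most kθ|R| points of R remain farther than 2 OPT from the
sample (`card_far_le`). - H contains fewer than φ log N of these far points
(`pivotProb_many_far_le`), so the pivot is not far (`CoveredWithin.next`). - H contains at least φ
log N of the roughly |R| N^(-ε/2) farthest points (`pivotProb_few_top_le`), so only those can
survive (`remaining_subset_top`).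

Any fixed t > 2/ε iterations therefore suffice, and failures add up to 3t N^(-x). Moving the optimal
centres to nearest points of C then costs 3 OPT, better than the required 5 OPT. The condition on γ
enters only through its consequence 3x ≤ φ, which is what the Chernoff bounds need. -/

theorem PMF.toOuterMeasure_bind_le {α β : Type*} (p : PMF α) (f : α → PMF β) (B : Set α)
    (E : Set β) (δ : ℝ≥0∞) (h : ∀ a ∈ p.support, a ∉ B → (f a).toOuterMeasure E ≤ δ) :
    (p.bind f).toOuterMeasure E ≤ p.toOuterMeasure B + δ := by
  have hle : ∀ a, (f a).toOuterMeasure E ≤ 1 := fun a => by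
    rw [PMF.toOuterMeasure_apply, ← (f a).tsum_coe]
    exact ENNReal.tsum_le_tsum fun b => Set.indicator_le_self _ _ b
  rw [PMF.toOuterMeasure_bind_apply, p.toOuterMeasure_apply B]
  calc ∑' a, p a * (f a).toOuterMeasure E
      ≤ ∑' a, (B.indicator p a + p a * δ) := by
        refine ENNReal.tsum_le_tsum fun a => ?_
        by_cases ha : a ∈ B
        · rw [Set.indicator_of_mem ha]
          exact le_add_right (mul_le_of_le_one_right' (hle a))
        · rw [Set.indicator_of_notMem ha, zero_add]
          by_cases hs : p a = 0
          · simp [hs]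
          · gcongr
            exact h a ((PMF.mem_support_iff _ _).2 hs) ha
    _ = _ := by rw [ENNReal.tsum_add, ENNReal.tsum_mul_right, p.tsum_coe, one_mul]

/-- The generating function of the number of points of `B` in a Bernoulli subset of `R`. -/
theorem sum_powerset_bernoulli_mul_pow {V M : Type*} [DecidableEq V] [CommSemiring M]
    {R B : Finset V} (hB : B ⊆ R) (p q z : M) :
    ∑ T ∈ R.powerset, p ^ T.card * q ^ (R.card - T.card) * z ^ (T ∩ B).card
      = (p * z + q) ^ B.card * (p + q) ^ (R.card - B.card) := by
  have h := Finset.prod_add (fun i => p * (if i ∈ B then z else 1)) (fun _ => q) R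
  have h2 : ∏ i ∈ R, (p * (if i ∈ B then z else 1) + q)
      = (p * z + q) ^ B.card * (p + q) ^ (R.card - B.card) := by
    rw [← Finset.prod_sdiff hB, mul_comm]
    congr 1
    · rw [Finset.prod_congr rfl (g := fun _ => p * z + q) fun i hi => by simp [hi]]
      simp
    · rw [Finset.prod_congr rfl (g := fun _ => p + q)
        fun i hi => by simp [(Finset.mem_sdiff.1 hi).2]]
      simp [Finset.card_sdiff_of_subset hB]
  rw [← h2, h]
  refine Finset.sum_congr rfl fun T hT => ?_
  have hT := Finset.mem_powerset.1 hT
  rw [Finset.prod_mul_distrib, Finset.prod_const, Finset.prod_const,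
    Finset.card_sdiff_of_subset hT, Finset.prod_ite_mem, Finset.prod_const]
  ring

/-- Markov's inequality for w z^|T ∩ B|, whose mean is given by the generating function. Taking z >
1 bounds upper tails, z < 1 lower tails, and z = 0 the event of missing B. -/
theorem bernoulliSubset_tail {V : Type*} [DecidableEq V] {R B : Finset V} (hB : B ⊆ R)
    {p : ℝ≥0∞} (hp : p ≤ 1) {q z w : ℝ} (hpq : p = ENNReal.ofReal q) (hq0 : 0 ≤ q) (hq1 : q ≤ 1)
    (hz : 0 ≤ z) (hw : 0 ≤ w) {E : Set (Finset V)}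
    (hE : ∀ T ∈ E, 1 ≤ w * z ^ (T ∩ B).card) :
    (bernoulliSubset R p hp).toOuterMeasure E
      ≤ ENNReal.ofReal (w * (1 - q + q * z) ^ B.card) := by
  have key : (bernoulliSubset R p hp).toOuterMeasure E
      ≤ ∑' T, bernoulliSubset R p hp T
          * (ENNReal.ofReal w * ENNReal.ofReal z ^ (T ∩ B).card) := by
    rw [PMF.toOuterMeasure_apply]
    refine ENNReal.tsum_le_tsum fun T => ?_
    by_cases hT : T ∈ E
    · rw [Set.indicator_of_mem hT]
      refine le_mul_of_one_le_right' ?_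
      rw [← ENNReal.ofReal_pow hz, ← ENNReal.ofReal_mul hw, ← ENNReal.ofReal_one]
      exact ENNReal.ofReal_le_ofReal (hE T hT)
    · simp [Set.indicator_of_notMem hT]
  refine key.trans (le_of_eq ?_)
  rw [tsum_eq_sum (s := R.powerset)
    (fun T hT => by
      have : ¬ T ⊆ R := fun h => hT (Finset.mem_powerset.2 h)
      simp [bernoulliSubset, this])]
  have : ∀ T ∈ R.powerset, bernoulliSubset R p hp T
      * (ENNReal.ofReal w * ENNReal.ofReal z ^ (T ∩ B).card)
      = ENNReal.ofReal w * (p ^ T.card * (1 - p) ^ (R.card - T.card)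
        * ENNReal.ofReal z ^ (T ∩ B).card) := fun T hT => by
    simp only [bernoulliSubset, PMF.ofFinset_apply, if_pos (Finset.mem_powerset.1 hT)]
    ring
  rw [Finset.sum_congr rfl this, ← Finset.mul_sum, sum_powerset_bernoulli_mul_pow hB,
    add_tsub_cancel_of_le hp, one_pow, mul_one, hpq, ← ENNReal.ofReal_one,
    ← ENNReal.ofReal_sub _ hq0, ← ENNReal.ofReal_mul hq0, ← ENNReal.ofReal_add (by positivity)
      (by linarith), ← ENNReal.ofReal_pow (by nlinarith [mul_nonneg hq0 hz]),
    ← ENNReal.ofReal_mul hw, add_comm]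

theorem bernoulliSubset_tail_exp {V : Type*} [DecidableEq V] {R B : Finset V} (hB : B ⊆ R)
    {p : ℝ≥0∞} (hp : p ≤ 1) {q z w : ℝ} (hpq : p = ENNReal.ofReal q) (hq0 : 0 ≤ q) (hq1 : q ≤ 1)
    (hz : 0 ≤ z) (hw : 0 ≤ w) {E : Set (Finset V)}
    (hE : ∀ T ∈ E, 1 ≤ w * z ^ (T ∩ B).card) :
    (bernoulliSubset R p hp).toOuterMeasure E
      ≤ ENNReal.ofReal (w * Real.exp (q * (z - 1) * B.card)) := by
  refine (bernoulliSubset_tail hB hp hpq hq0 hq1 hz hw hE).trans (ENNReal.ofReal_le_ofReal ?_)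
  gcongr
  have h0 : 0 ≤ 1 - q + q * z := by nlinarith [mul_nonneg hq0 hz]
  rw [mul_comm (q * (z - 1)), Real.exp_nat_mul]
  gcongr
  linarith [Real.add_one_le_exp (q * (z - 1))]

theorem bernoulliSubset_disjoint_le {V : Type*} [DecidableEq V] {R B : Finset V} (hB : B ⊆ R)
    {p : ℝ≥0∞} (hp : p ≤ 1) {y : ℝ} (hpy : p = min 1 (ENNReal.ofReal y)) (hy : 0 ≤ y)
    (hne : B.Nonempty) :
    (bernoulliSubset R p hp).toOuterMeasure {A | A ∩ B = ∅}
      ≤ ENNReal.ofReal (Real.exp (-(y * B.card))) := by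
  have hE : ∀ T ∈ {A : Finset V | A ∩ B = ∅}, (1 : ℝ) ≤ 1 * 0 ^ (T ∩ B).card := fun T hT => by
    rw [Set.mem_ofPred_eq] at hT
    simp [hT]
  rcases le_total 1 y with h | h
  -- With the probability capped at 1 the exponential form would lose the factor y in the exponent.
  -- The exact bound is 0 here, because B is nonempty.
  · have hp1 : p = ENNReal.ofReal 1 := by
      rw [hpy, ENNReal.ofReal_one]
      exact min_eq_left (by rwa [ENNReal.one_le_ofReal])
    refine (bernoulliSubset_tail hB hp hp1 zero_le_one le_rfl le_rfl zero_le_one hE).trans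
      (ENNReal.ofReal_le_ofReal ?_)
    simp [hne.ne_empty, Real.exp_nonneg]
  · have hp1 : p = ENNReal.ofReal y := by
      rw [hpy]
      exact min_eq_right (by rwa [ENNReal.ofReal_le_one])
    refine (bernoulliSubset_tail_exp hB hp hp1 hy h le_rfl zero_le_one hE).trans
      (ENNReal.ofReal_le_ofReal ?_)
    simp

/-! ### Pivots -/

theorem exists_top_subset {V α : Type*} [DecidableEq V] [LinearOrder α] (f : V → α)
    (R : Finset V) (j : ℕ) (hj : j ≤ R.card) :
    ∃ B ⊆ R, B.card = j ∧ ∀ y ∈ R, y ∉ B → ∀ h ∈ B, f y ≤ f h := by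
  induction j with
  | zero => exact ⟨∅, by simp⟩
  | succ j ih =>
    obtain ⟨B, hBR, hBc, hB⟩ := ih (by omega)
    have hne : (R \ B).Nonempty := by
      rw [← Finset.card_pos, Finset.card_sdiff_of_subset hBR]
      omega
    obtain ⟨z, hz, hmax⟩ := Finset.exists_max_image (R \ B) f hne
    rw [Finset.mem_sdiff] at hz
    refine ⟨insert z B, Finset.insert_subset hz.1 hBR, by simp [hz.2, hBc], ?_⟩
    intro y hy hyB h hh
    rw [Finset.mem_insert, not_or] at hyB
    rcases Finset.mem_insert.1 hh with rfl | hh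
    · exact hmax y (Finset.mem_sdiff.2 ⟨hy, hyB.2⟩)
    · exact hB y hy hyB.2 h hh

theorem exists_isPivot {V : Type*} [MetricSpace V] (H S : Finset V) (m : ℕ) (hm : 0 < m)
    (hmH : m ≤ H.card) : ∃ v, IsPivot H S m v := by
  classical
  obtain ⟨B, hBH, hBc, hB⟩ := exists_top_subset
    (fun x => Metric.infEDist x (S : Set V)) H m hmH
  obtain ⟨v, hv, hmin⟩ := Finset.exists_min_image B
    (fun x => Metric.infEDist x (S : Set V)) (Finset.card_pos.1 (by omega))
  refine ⟨v, hBH hv, ?_, ?_⟩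
  · have hsub : {h ∈ (H : Set V) | Metric.infEDist v (S : Set V)
        < Metric.infEDist h (S : Set V)} ⊆ ((B.erase v : Finset V) : Set V) := by
      rintro h ⟨hH, hlt⟩
      refine Finset.mem_coe.2 (Finset.mem_erase.2 ⟨fun e => by simp [e] at hlt, ?_⟩)
      by_contra hhB
      exact absurd (hB h hH hhB v hv) (not_le.2 hlt)
    have := Set.ncard_le_ncard hsub (Finset.finite_toSet _)
    rw [Set.ncard_coe_finset, Finset.card_erase_of_mem hv] at this
    omega
  · rw [← hBc, ← Set.ncard_coe_finset B]
    exact Set.ncard_le_ncard (fun h hh => ⟨hBH hh, hmin h hh⟩)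
      (H.finite_toSet.subset fun h hh => hh.1)

/-- A survivor outside B would be strictly farther than the pivot, and so would all of H ∩ B. That
puts too many points of H ahead of the pivot. -/
theorem remaining_subset_top {V : Type*} [MetricSpace V] [Fintype V] [DecidableEq V] {φ : ℝ}
    {R H S B : Finset V} (hB : ∀ y ∈ R, y ∉ B → ∀ h ∈ B,
      Metric.infEDist y (S : Set V) ≤ Metric.infEDist h (S : Set V))
    (hpos : 0 < φ * Real.log (Fintype.card V))
    (hH : φ * Real.log (Fintype.card V) ≤ (H ∩ B).card) : remaining φ R H S ⊆ B := by
  intro x hx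
  have hm : ⌈φ * Real.log (Fintype.card V)⌉₊ ≤ (H ∩ B).card := Nat.ceil_le.2 hH
  obtain ⟨v, hv⟩ := exists_isPivot H S _ (Nat.ceil_pos.2 hpos)
    (hm.trans (Finset.card_le_card Finset.inter_subset_left))
  simp only [remaining, Finset.mem_filter, not_or, not_exists, not_and, not_le] at hx
  by_contra hxB
  have hsub : ((H ∩ B : Finset V) : Set V) ⊆ {h ∈ (H : Set V) |
      Metric.infEDist v (S : Set V) < Metric.infEDist h (S : Set V)} := fun h hh => by
    rw [Finset.mem_coe, Finset.mem_inter] at hh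
    exact ⟨hh.1, (hx.2.2 v hv).trans_le (hB x hx.1 hxB h hh.2)⟩
  have := Set.ncard_le_ncard hsub (H.finite_toSet.subset fun h hh => hh.1)
  rw [Set.ncard_coe_finset] at this
  exact absurd hv.2.1 (not_lt.2 (hm.trans this))

/-- Every point is still unrepresented or within distance `2 r` of the sample. -/
def CoveredWithin {V : Type*} [MetricSpace V] (r : ℝ≥0∞) (s : EIMState V) : Prop :=
  ∀ x, x ∈ s.R ∨ Metric.infEDist x (s.S : Set V) ≤ 2 * r

/-- If the pivot were farther than 2r, so would be every point of H ranked at least as far, and H ∩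
F would have at least ⌈φ log n⌉ points. -/
theorem CoveredWithin.next {V : Type*} [MetricSpace V] [Fintype V] [DecidableEq V] {φ : ℝ}
    {r : ℝ≥0∞} {s : EIMState V} (hs : CoveredWithin r s) {A H F : Finset V}
    (hF : ∀ x ∈ s.R, 2 * r < Metric.infEDist x ((s.S ∪ A : Finset V) : Set V) → x ∈ F)
    (hHR : H ⊆ s.R) (hH : (H ∩ F).card < φ * Real.log (Fintype.card V)) :
    CoveredWithin r ⟨s.S ∪ A, remaining φ s.R H (s.S ∪ A)⟩ := by
  intro x
  rcases hs x with hx | hx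
  · rw [or_iff_not_imp_left]
    intro hrem
    simp only [remaining, Finset.mem_filter, not_and, not_not] at hrem
    rcases hrem hx with h | ⟨v, hv, hxv⟩
    · rw [Metric.infEDist_zero_of_mem (Finset.mem_coe.2 h)]
      exact zero_le
    · refine hxv.trans ?_
      by_contra! hlt
      have hsub : {h ∈ (H : Set V) | Metric.infEDist v ((s.S ∪ A : Finset V) : Set V)
          ≤ Metric.infEDist h ((s.S ∪ A : Finset V) : Set V)}
          ⊆ ((H ∩ F : Finset V) : Set V) := fun h hh =>
        Finset.mem_coe.2 (Finset.mem_inter.2 ⟨hh.1, hF h (hHR hh.1) (hlt.trans_le hh.2)⟩)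
      have := hv.2.2.trans (Set.ncard_le_ncard hsub (Finset.finite_toSet _))
      rw [Set.ncard_coe_finset] at this
      exact absurd hH (not_lt.2 (Nat.ceil_le.1 this))
  · exact Or.inr ((Metric.infEDist_anti (by simp)).trans hx)

/-! ### Clusters -/

theorem exists_optimal_centers (V : Type*) [MetricSpace V] [Fintype V] [Nonempty V]
    (k : ℕ) (hk : 1 ≤ k) :
    ∃ (T : Finset V) (c : V → V), T.card ≤ k ∧ (∀ x, c x ∈ T) ∧
      ∀ x, edist x (c x) ≤ optCost V k := by
  classical
  -- Finiteness of the optimum need not be shown: if it were infinite, any single centre would do.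
  by_cases htop : optCost V k = ⊤
  · obtain ⟨v⟩ := ‹Nonempty V›
    exact ⟨{v}, fun _ => v, by simpa using hk, by simp, by simp [htop]⟩
  obtain ⟨T, hT⟩ := exists_eq_ciInf_of_finite
    (f := fun T : Finset V => ⨅ (_ : T ⊆ Finset.univ) (_ : T.card ≤ k), coverCost T)
  have hT' : (⨅ (_ : T ⊆ Finset.univ) (_ : T.card ≤ k), coverCost T) = optCost V k := hT
  have hTk : T.card ≤ k := by
    by_contra h
    simp [h] at hT'
    exact htop hT'.symm
  have hcost : coverCost T = optCost V k := by simpa [hTk] using hT'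
  have hx : ∀ x, Metric.infEDist x (T : Set V) ≤ optCost V k := fun x =>
    hcost ▸ le_iSup (fun x => Metric.infEDist x (T : Set V)) x
  have hne : (T : Set V).Nonempty := by
    by_contra h
    rw [Set.not_nonempty_iff_eq_empty] at h
    obtain ⟨v⟩ := ‹Nonempty V›
    have := hx v
    rw [h, Metric.infEDist_empty, top_le_iff] at this
    exact htop this
  choose c hc hce using fun x => T.finite_toSet.isCompact.exists_infEDist_eq_edist hne x
  exact ⟨T, c, hTk, hc, fun x => hce x ▸ hx x⟩

theorem CoveredWithin.optFrom_le {V : Type*} [MetricSpace V] [Fintype V] [DecidableEq V]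
    [Nonempty V] {k : ℕ} (hk : 1 ≤ k) {s : EIMState V} (hs : CoveredWithin (optCost V k) s) :
    optFrom k (s.S ∪ s.R) ≤ 5 * optCost V k := by
  by_cases htop : optCost V k = ⊤
  · rw [htop, ENNReal.mul_top (by norm_num)]
    exact le_top
  have hx : ∀ x, Metric.infEDist x ((s.S ∪ s.R : Finset V) : Set V) ≤ 2 * optCost V k := by
    intro x
    rcases hs x with h | h
    · rw [Metric.infEDist_zero_of_mem (by simp [h])]
      exact zero_le
    · exact (Metric.infEDist_anti (by simp)).trans h
  have hne : ((s.S ∪ s.R : Finset V) : Set V).Nonempty := by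
    by_contra h
    rw [Set.not_nonempty_iff_eq_empty] at h
    obtain ⟨v⟩ := ‹Nonempty V›
    have := hx v
    rw [h, Metric.infEDist_empty, top_le_iff] at this
    exact ENNReal.mul_ne_top (by norm_num) htop this
  choose g hg hge using fun x =>
    (s.S ∪ s.R).finite_toSet.isCompact.exists_infEDist_eq_edist hne x
  obtain ⟨T, c, hTk, hcT, hc⟩ := exists_optimal_centers V k hk
  have hsub : T.image g ⊆ s.S ∪ s.R := fun y hy => by
    obtain ⟨x, -, rfl⟩ := Finset.mem_image.1 hy
    exact hg x
  have hle : optFrom k (s.S ∪ s.R) ≤ coverCost (T.image g) :=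
    iInf_le_of_le _ (iInf_le_of_le hsub (iInf_le _ (Finset.card_image_le.trans hTk)))
  refine hle.trans (iSup_le fun x => ?_)
  calc Metric.infEDist x ((T.image g : Finset V) : Set V)
        ≤ edist x (g (c x)) := Metric.infEDist_le_edist_of_mem
          (Finset.mem_coe.2 (Finset.mem_image_of_mem g (hcT x)))
      _ ≤ edist x (c x) + edist (c x) (g (c x)) := edist_triangle _ _ _
      _ ≤ optCost V k + 2 * optCost V k := add_le_add (hc x) (hge (c x) ▸ hx (c x))
      _ = 3 * optCost V k := by ring
      _ ≤ 5 * optCost V k := by gcongr; norm_num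

/-- If a sample meets every cluster with at least `θ` points in `R`, then at most `k θ` points
of `R` are farther than twice the radius from it. -/
theorem card_far_le {V : Type*} [MetricSpace V] [DecidableEq V] {r : ℝ≥0∞} {T : Finset V}
    {c : V → V} {k : ℕ} {θ : ℝ} (hθ : 0 ≤ θ) (hTk : T.card ≤ k) (hcT : ∀ x, c x ∈ T)
    (hc : ∀ x, edist x (c x) ≤ r) {R A F S : Finset V}
    (hA : ∀ t ∈ T, θ ≤ (R.filter (c · = t)).card → (A ∩ R.filter (c · = t)) ≠ ∅)
    (hFR : F ⊆ R) (hAS : A ⊆ S)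
    (hF : ∀ x ∈ F, 2 * r < Metric.infEDist x (S : Set V)) :
    (F.card : ℝ) ≤ k * θ := by
  have hsmall : ∀ t ∈ F.image c, ((R.filter (c · = t)).card : ℝ) ≤ θ := by
    intro t ht
    obtain ⟨x, hx, rfl⟩ := Finset.mem_image.1 ht
    by_contra! hlt
    obtain ⟨y, hy⟩ := Finset.nonempty_iff_ne_empty.2 (hA (c x) (hcT x) hlt.le)
    simp only [Finset.mem_inter, Finset.mem_filter] at hy
    refine absurd (hF x hx) (not_lt.2 ?_)
    calc Metric.infEDist x (S : Set V) ≤ edist x y :=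
          Metric.infEDist_le_edist_of_mem (Finset.mem_coe.2 (hAS hy.1))
      _ ≤ edist x (c x) + edist (c x) y := edist_triangle _ _ _
      _ ≤ r + r := add_le_add (hc x) (by rw [edist_comm, ← hy.2.2]; exact hc y)
      _ = 2 * r := (two_mul r).symm
  have hsub : F ⊆ (F.image c).biUnion fun t => R.filter (c · = t) := fun x hx =>
    Finset.mem_biUnion.2 ⟨c x, Finset.mem_image_of_mem c hx, by simp [hFR hx]⟩
  have hcard : (F.image c).card ≤ k := (Finset.card_le_card fun t ht => by
    obtain ⟨x, -, rfl⟩ := Finset.mem_image.1 ht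
    exact hcT x).trans hTk
  calc (F.card : ℝ) ≤ ((F.image c).biUnion fun t => R.filter (c · = t)).card := by
        exact_mod_cast Finset.card_le_card hsub
    _ ≤ ∑ t ∈ F.image c, ((R.filter (c · = t)).card : ℝ) := by
        exact_mod_cast Finset.card_biUnion_le
    _ ≤ ∑ t ∈ F.image c, θ := Finset.sum_le_sum hsmall
    _ = (F.image c).card * θ := by simp
    _ ≤ k * θ := by gcongr

/-! ### One iteration -/

theorem sampleProb_miss_cluster_le {V : Type*} [Fintype V] [DecidableEq V] {k : ℕ} (hk : 1 ≤ k)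
    {ε x : ℝ} (hx : 0 ≤ x) (hn : 0 < Real.log (Fintype.card V)) {R T : Finset V}
    (hR : R.Nonempty) (c : V → V) :
    (bernoulliSubset R (sampleProb k ε R) (min_le_left _ _)).toOuterMeasure
      {A | ∃ t ∈ T, (1 + x) / 9 * R.card / (k * (Fintype.card V : ℝ) ^ ε)
        ≤ (R.filter (c · = t)).card ∧ A ∩ R.filter (c · = t) = ∅}
      ≤ ENNReal.ofReal ((Fintype.card V : ℝ) ^ (-x)) := by
  set N : ℝ := ((Fintype.card V : ℕ) : ℝ) with hN
  set θ := (1 + x) / 9 * R.card / (k * N ^ ε) with hθ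
  have hR0 : (0 : ℝ) < R.card := by exact_mod_cast hR.card_pos
  have hk0 : (0 : ℝ) < k := by exact_mod_cast hk
  have hN0 : 0 < N := by
    rcases (Nat.cast_nonneg (Fintype.card V) : (0 : ℝ) ≤ _).lt_or_eq with h | h
    · exact h
    · rw [hN, ← h] at hn
      simp at hn
  have hNε : 0 < N ^ ε := Real.rpow_pos_of_pos hN0 _
  have hθ0 : 0 < θ := by positivity
  have hset : {A : Finset V | ∃ t ∈ T, θ ≤ (R.filter (c · = t)).card ∧
      A ∩ R.filter (c · = t) = ∅} = ⋃ t ∈ T, {A | θ ≤ (R.filter (c · = t)).card ∧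
      A ∩ R.filter (c · = t) = ∅} := by
    ext A
    simp only [Set.mem_ofPred_eq, Set.mem_iUnion, exists_prop]
  have hone : ∀ t ∈ T, (bernoulliSubset R (sampleProb k ε R) (min_le_left _ _)).toOuterMeasure
      {A | θ ≤ (R.filter (c · = t)).card ∧ A ∩ R.filter (c · = t) = ∅}
      ≤ ENNReal.ofReal (N ^ (-(1 + x))) := by
    intro t _
    by_cases hbig : θ ≤ (R.filter (c · = t)).card
    · simp only [hbig, true_and]
      refine (bernoulliSubset_disjoint_le (Finset.filter_subset _ _) (min_le_left _ _) rfl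
        (by positivity) ?_).trans (ENNReal.ofReal_le_ofReal ?_)
      · rw [← Finset.card_pos]
        exact_mod_cast hθ0.trans_le hbig
      · rw [Real.rpow_def_of_pos hN0 (-(1 + x)), Real.exp_le_exp, ← hN]
        -- The threshold θ makes the expected number of hits at least (1 + x) log N. The extra 1
        -- pays for the union bound over at most N centres.
        have h1 : 9 * k * N ^ ε * Real.log N / R.card * θ = (1 + x) * Real.log N := by
          rw [hθ]
          field_simp
        have h2 := mul_le_mul_of_nonneg_left hbig
          (show 0 ≤ 9 * k * N ^ ε * Real.log N / R.card by positivity)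
        linarith
    · simp [hbig]
  rw [hset]
  calc
    _ ≤ ∑ t ∈ T, (bernoulliSubset R (sampleProb k ε R) (min_le_left _ _)).toOuterMeasure
        {A | θ ≤ (R.filter (c · = t)).card ∧ A ∩ R.filter (c · = t) = ∅} :=
        MeasureTheory.measure_biUnion_finset_le T _
    _ ≤ ∑ t ∈ T, ENNReal.ofReal (N ^ (-(1 + x))) := Finset.sum_le_sum hone
    _ = ENNReal.ofReal (T.card * N ^ (-(1 + x))) := by
        rw [Finset.sum_const, nsmul_eq_mul, ENNReal.ofReal_mul (by positivity),
          ENNReal.ofReal_natCast]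
    _ ≤ ENNReal.ofReal (N ^ (-x)) := by
        refine ENNReal.ofReal_le_ofReal ?_
        have h1 : N ^ (-x) = N * N ^ (-(1 + x)) := by
          rw [show -x = 1 + -(1 + x) by ring, Real.rpow_add hN0, Real.rpow_one]
        rw [h1]
        gcongr
        rw [hN]
        exact_mod_cast Finset.card_le_univ T

theorem pivotProb_eq_ofReal {V : Type*} [Fintype V] (ε : ℝ) (R : Finset V)
    (_hn : 0 ≤ Real.log (Fintype.card V)) :
    ∃ q : ℝ, pivotProb ε R = ENNReal.ofReal q ∧ 0 ≤ q ∧ q ≤ 1 ∧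
      q = min 1 (4 * (Fintype.card V : ℝ) ^ ε * Real.log (Fintype.card V) / R.card) :=
  ⟨_, by rw [pivotProb, ENNReal.ofReal_min, ENNReal.ofReal_one],
    le_min zero_le_one (by positivity), min_le_left _ _, rfl⟩

/-- The mean of |H ∩ F| is at most (8/9) x log N. With z = e and e - 1 ≤ 2, the exponent is at most
(16/9 - 3) x log N ≤ -x log N. -/
theorem pivotProb_many_far_le {V : Type*} [Fintype V] [DecidableEq V] {ε φ x : ℝ} (hx : 1 ≤ x)
    (hφ : 3 * x ≤ φ) (hn : 0 < Real.log (Fintype.card V)) {R F : Finset V}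
    (hR : R.Nonempty) (hFR : F ⊆ R)
    (hF : (F.card : ℝ) ≤ (1 + x) / 9 * R.card / (Fintype.card V : ℝ) ^ ε) :
    (bernoulliSubset R (pivotProb ε R) (min_le_left _ _)).toOuterMeasure
      {H | φ * Real.log (Fintype.card V) ≤ (H ∩ F).card}
      ≤ ENNReal.ofReal ((Fintype.card V : ℝ) ^ (-x)) := by
  obtain ⟨q, hq, hq0, hq1, hqe⟩ := pivotProb_eq_ofReal ε R hn.le
  set N : ℝ := ((Fintype.card V : ℕ) : ℝ) with hN
  have hR0 : (0 : ℝ) < R.card := by exact_mod_cast hR.card_pos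
  have hN0 : 0 < N := by
    rw [hN]
    exact_mod_cast (hR.card_pos.trans_le (Finset.card_le_univ R))
  have hNε : 0 < N ^ ε := Real.rpow_pos_of_pos hN0 _
  refine (bernoulliSubset_tail_exp hFR (min_le_left _ _) hq hq0 hq1 (Real.exp_nonneg 1)
    (Real.exp_nonneg (-(φ * Real.log N))) ?_).trans (ENNReal.ofReal_le_ofReal ?_)
  · intro H hH
    rw [← Real.exp_nat_mul, ← Real.exp_add]
    refine Real.one_le_exp ?_
    have : φ * Real.log N ≤ (H ∩ F).card := hH
    linarith
  · rw [Real.rpow_def_of_pos hN0, ← Real.exp_add, Real.exp_le_exp]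
    have he : Real.exp 1 - 1 ≤ 2 := by linarith [Real.exp_one_lt_d9]
    have he0 : 0 ≤ Real.exp 1 - 1 := by linarith [Real.add_one_le_exp (1 : ℝ)]
    have h1 : q * F.card ≤ 8 / 9 * (x * Real.log N) := by
      calc q * F.card ≤ (4 * N ^ ε * Real.log N / R.card) * ((1 + x) / 9 * R.card / N ^ ε) := by
            gcongr
            rw [hqe]
            exact min_le_right _ _
        _ = 4 / 9 * ((1 + x) * Real.log N) := by field_simp
        _ ≤ 4 / 9 * ((2 * x) * Real.log N) := by gcongr; linarith
        _ = _ := by ring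
    have h2 : 3 * x * Real.log N ≤ φ * Real.log N := by gcongr
    have h3 : q * F.card * (Real.exp 1 - 1) ≤ 8 / 9 * (x * Real.log N) * 2 := by gcongr
    have h4 : 0 ≤ x * Real.log N := by positivity
    linarith

/-- The mean of |H ∩ B| is at least 2 N^(ε/2) log N ≥ 4φ log N. With z = 1/e and 1 - 1/e ≥ 1/2, the
exponent is at most -φ log N. The lower bound on |R| keeps the probability uncapped, so that this
mean is attained. -/
theorem pivotProb_few_top_le {V : Type*} [Fintype V] [DecidableEq V] {ε φ x : ℝ} (hx : 1 ≤ x)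
    (hφ : 3 * x ≤ φ) (hn : 0 < Real.log (Fintype.card V))
    (hφN : 2 * φ ≤ (Fintype.card V : ℝ) ^ (ε / 2)) {R B : Finset V}
    (hR : 4 * (Fintype.card V : ℝ) ^ ε * Real.log (Fintype.card V) ≤ R.card) (hBR : B ⊆ R)
    (hB : R.card * (Fintype.card V : ℝ) ^ (-(ε / 2)) / 2 ≤ B.card) :
    (bernoulliSubset R (pivotProb ε R) (min_le_left _ _)).toOuterMeasure
      {H | ((H ∩ B).card : ℝ) < φ * Real.log (Fintype.card V)}
      ≤ ENNReal.ofReal ((Fintype.card V : ℝ) ^ (-x)) := by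
  obtain ⟨q, hq, hq0, hq1, hqe⟩ := pivotProb_eq_ofReal ε R hn.le
  set N : ℝ := ((Fintype.card V : ℕ) : ℝ) with hN
  have hN0 : 0 < N := by
    rcases (Nat.cast_nonneg (Fintype.card V) : (0 : ℝ) ≤ _).lt_or_eq with h | h
    · exact h
    · rw [hN, ← h] at hn
      simp at hn
  have hNε : 0 < N ^ ε := Real.rpow_pos_of_pos hN0 _
  have hR0 : (0 : ℝ) < R.card := lt_of_lt_of_le (by positivity) hR
  rw [min_eq_right ((div_le_one hR0).2 hR)] at hqe
  refine (bernoulliSubset_tail_exp hBR (min_le_left _ _) hq hq0 hq1 (Real.exp_nonneg (-1))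
    (Real.exp_nonneg (φ * Real.log N)) ?_).trans (ENNReal.ofReal_le_ofReal ?_)
  · intro H hH
    rw [← Real.exp_nat_mul, ← Real.exp_add]
    refine Real.one_le_exp ?_
    have : ((H ∩ B).card : ℝ) < φ * Real.log N := hH
    linarith
  · rw [Real.rpow_def_of_pos hN0, ← Real.exp_add, Real.exp_le_exp]
    have he : (1 : ℝ) / 2 ≤ 1 - Real.exp (-1) := by linarith [Real.exp_neg_one_lt_d9]
    have h1 : 2 * (N ^ (ε / 2) * Real.log N) ≤ q * B.card := by
      have hsplit : N ^ ε * N ^ (-(ε / 2)) = N ^ (ε / 2) := by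
        rw [← Real.rpow_add hN0]
        ring_nf
      calc 2 * (N ^ (ε / 2) * Real.log N)
          = 4 * N ^ ε * Real.log N / R.card * (R.card * N ^ (-(ε / 2)) / 2) := by
            rw [← hsplit]
            field_simp
            ring
        _ ≤ q * B.card := by rw [hqe]; gcongr
    have h2 : 2 * φ * Real.log N ≤ N ^ (ε / 2) * Real.log N := by gcongr
    have h3 : 2 * (N ^ (ε / 2) * Real.log N) * (1 / 2) ≤ q * B.card * (1 - Real.exp (-1)) := by
      gcongr
    have h4 : 3 * x * Real.log N ≤ φ * Real.log N := by gcongr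
    have h5 : 0 ≤ x * Real.log N := by positivity
    linarith

theorem bernoulliSubset_support_subset {V : Type*} [DecidableEq V] {R : Finset V} {p : ℝ≥0∞}
    {hp : p ≤ 1} {T : Finset V} (hT : T ∈ (bernoulliSubset R p hp).support) : T ⊆ R := by
  by_contra h
  rw [PMF.mem_support_iff] at hT
  exact hT (by simp [bernoulliSubset, h])

/-- The number of points is large enough for one iteration of the loop to succeed. -/
structure LargeSpace (ε φ N : ℝ) : Prop where
  log_pos : 0 < Real.log N
  le_log : ε / 4 ≤ Real.log N
  le_rpow : 2 * φ ≤ N ^ (ε / 2)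
  one_le : 1 ≤ 4 / ε * N ^ (ε / 2) * Real.log N

theorem eimStep_failure_le {V : Type*} [MetricSpace V] [Fintype V] [DecidableEq V] [Nonempty V]
    {k : ℕ} (hk : 1 ≤ k) {ε φ x : ℝ} (hε : 0 < ε) (hx : 1 ≤ x) (hφ : 3 * x ≤ φ)
    (hV : LargeSpace ε φ (Fintype.card V)) {s : EIMState V} (hs : ¬ Halted k ε s)
    (hcov : CoveredWithin (optCost V k) s) :
    (eimStep k ε φ s).toOuterMeasure {s' | ¬ (CoveredWithin (optCost V k) s' ∧
      (s'.R.card : ℝ) ≤ s.R.card * (Fintype.card V : ℝ) ^ (-(ε / 2)))}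
      ≤ 3 * ENNReal.ofReal ((Fintype.card V : ℝ) ^ (-x)) := by
  obtain ⟨T, c, hTk, hcT, hc⟩ := exists_optimal_centers V k hk
  obtain ⟨hn, hL, hφN, hone⟩ := hV
  rw [Halted, not_le] at hs
  have hstep : eimStep k ε φ s =
      (bernoulliSubset s.R (sampleProb k ε s.R) (min_le_left _ _)).bind fun A =>
      (bernoulliSubset s.R (pivotProb ε s.R) (min_le_left _ _)).bind fun H =>
        PMF.pure ⟨s.S ∪ A, remaining φ s.R H (s.S ∪ A)⟩ := by
    rw [eimStep, if_neg (by rwa [Halted, not_le])]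
  rw [hstep]
  set N : ℝ := ((Fintype.card V : ℕ) : ℝ) with hN
  have hN1 : 1 ≤ N := by
    rw [hN]
    exact_mod_cast Fintype.card_pos (α := V)
  have hN0 : 0 < N := by linarith
  have hNε : 0 < N ^ ε := Real.rpow_pos_of_pos hN0 _
  have hk1 : (1 : ℝ) ≤ k := by exact_mod_cast hk
  have hk0 : (0 : ℝ) < k := by linarith
  have hR1 : 4 / ε * N ^ ε * Real.log N < s.R.card := by
    refine lt_of_le_of_lt ?_ hs
    have : 0 ≤ 4 / ε * N ^ ε * Real.log N := by positivity
    nlinarith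
  have hR0 : (0 : ℝ) < s.R.card := lt_of_le_of_lt (by positivity) hR1
  have hRne : s.R.Nonempty := Finset.card_pos.1 (by exact_mod_cast hR0)
  have hRN : (s.R.card : ℝ) ≤ N := by
    rw [hN]
    exact_mod_cast Finset.card_le_univ s.R
  -- For ε ≥ 1 the halting threshold is already at least N ≥ |R|, so the loop would have stopped.
  have hε1 : ε < 1 := by
    by_contra! h
    have h1 : N ≤ N ^ ε := Real.self_le_rpow_of_one_le hN1 h
    have h2 : 1 ≤ 4 / ε * Real.log N := by
      rw [div_mul_eq_mul_div, one_le_div hε]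
      linarith
    nlinarith
  have hR2 : 4 * N ^ ε * Real.log N ≤ s.R.card := by
    refine le_trans ?_ hR1.le
    gcongr
    rw [le_div_iff₀ hε]
    linarith
  have hsplit : N ^ ε * N ^ (-(ε / 2)) = N ^ (ε / 2) := by
    rw [← Real.rpow_add hN0]
    ring_nf
  have hRb : 1 ≤ s.R.card * N ^ (-(ε / 2)) := by
    calc 1 ≤ 4 / ε * N ^ (ε / 2) * Real.log N := hone
      _ = 4 / ε * N ^ ε * Real.log N * N ^ (-(ε / 2)) := by rw [← hsplit]; ring
      _ ≤ _ := by gcongr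
  -- The target size for the next R. As the real number is at least 1, rounding down loses at most a
  -- factor 2, the one allowed in `pivotProb_few_top_le`.
  set b := ⌊s.R.card * N ^ (-(ε / 2))⌋₊ with hb
  have hbhalf : s.R.card * N ^ (-(ε / 2)) / 2 ≤ b := by
    have h1 := Nat.lt_floor_add_one (s.R.card * N ^ (-(ε / 2)))
    have h2 : (1 : ℝ) ≤ b := by exact_mod_cast Nat.le_floor (by simpa using hRb)
    linarith
  have hble : (b : ℝ) ≤ s.R.card * N ^ (-(ε / 2)) := Nat.floor_le (by positivity)
  have hbR : b ≤ s.R.card := by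
    have : N ^ (-(ε / 2)) ≤ 1 := Real.rpow_le_one_of_one_le_of_nonpos hN1 (by linarith)
    have : (b : ℝ) ≤ s.R.card := hble.trans (mul_le_of_le_one_right hR0.le this)
    exact_mod_cast this
  -- One term for A and two for H given A. The final 0 says that success is certain once all three
  -- bad events are avoided.
  have h3 : (3 : ℝ≥0∞) * ENNReal.ofReal (N ^ (-x)) = ENNReal.ofReal (N ^ (-x))
      + (ENNReal.ofReal (N ^ (-x)) + ENNReal.ofReal (N ^ (-x)) + 0) := by ring
  rw [h3]
  refine (PMF.toOuterMeasure_bind_le _ _ _ _ _ fun A hAs hA => ?_).trans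
    (add_le_add_left (sampleProb_miss_cluster_le (T := T) hk (by linarith) hn hRne c) _)
  simp only [Set.mem_ofPred_eq, not_exists, not_and] at hA
  have hAR := bernoulliSubset_support_subset hAs
  -- B and F depend on A through distances to the updated sample. They are fixed before H is drawn,
  -- so the tail bounds apply conditionally on A.
  obtain ⟨B, hBR, hBc, hB⟩ := exists_top_subset
    (fun x => Metric.infEDist x ((s.S ∪ A : Finset V) : Set V)) s.R b hbR
  classical
  set F := s.R.filter fun x =>
    2 * optCost V k < Metric.infEDist x ((s.S ∪ A : Finset V) : Set V) with hFdef
  have hF : (F.card : ℝ) ≤ (1 + x) / 9 * s.R.card / N ^ ε := by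
    refine (card_far_le (by positivity) hTk hcT hc hA (Finset.filter_subset _ _)
      Finset.subset_union_right fun x hx => (Finset.mem_filter.1 hx).2).trans (le_of_eq ?_)
    rw [← hN]
    field_simp
  have hfar := pivotProb_many_far_le hx hφ hn hRne (Finset.filter_subset _ _) hF
  have htop := pivotProb_few_top_le hx hφ hn hφN hR2 hBR (by rw [hBc]; exact hbhalf)
  refine (PMF.toOuterMeasure_bind_le _ _ _ _ _ fun H hHs hH => ?_).trans
    (add_le_add_left ((MeasureTheory.measure_union_le _ _).trans (add_le_add hfar htop)) 0)
  simp only [Set.mem_union, Set.mem_ofPred_eq, not_or, not_le, not_lt] at hH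
  have hHR := bernoulliSubset_support_subset hHs
  rw [PMF.toOuterMeasure_pure_apply, if_neg]
  simp only [Set.mem_ofPred_eq, not_not]
  refine ⟨hcov.next (fun x hx hlt => Finset.mem_filter.2 ⟨hx, hlt⟩) hHR hH.1, ?_⟩
  have hsub := remaining_subset_top hB (by have : 0 < φ := by linarith
                                           positivity) hH.2
  refine le_trans ?_ hble
  rw [← hBc]
  exact_mod_cast Finset.card_le_card hsub

/-! ### The whole loop -/

/-- Every point is represented, and the loop has been left or `R` has shrunk by a factor
`n ^ (ε / 2)` in each of `t` iterations. -/
def OnTrack {V : Type*} [MetricSpace V] [Fintype V] (k : ℕ) (ε : ℝ) (t : ℕ)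
    (s : EIMState V) : Prop :=
  CoveredWithin (optCost V k) s ∧ (Halted k ε s ∨
    (s.R.card : ℝ) ≤ Fintype.card V * ((Fintype.card V : ℝ) ^ (-(ε / 2))) ^ t)

theorem eimRun_failure_le {V : Type*} [MetricSpace V] [Fintype V] [DecidableEq V] [Nonempty V]
    {k : ℕ} (hk : 1 ≤ k) {ε φ x : ℝ} (hε : 0 < ε) (hx : 1 ≤ x) (hφ : 3 * x ≤ φ)
    (hV : LargeSpace ε φ (Fintype.card V)) (t : ℕ) :
    (eimRun V k ε φ t).toOuterMeasure {s | ¬ OnTrack k ε t s}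
      ≤ t * (3 * ENNReal.ofReal ((Fintype.card V : ℝ) ^ (-x))) := by
  induction t with
  | zero =>
    rw [eimRun, PMF.toOuterMeasure_pure_apply, if_neg]
    · exact zero_le
    · simp [OnTrack, CoveredWithin]
  | succ t ih =>
    rw [eimRun, Nat.cast_succ, add_mul, one_mul]
    refine (PMF.toOuterMeasure_bind_le _ _ _ _ _ fun s _ hs => ?_).trans (add_le_add_left ih _)
    simp only [Set.mem_ofPred_eq, not_not] at hs
    by_cases hhalt : Halted k ε s
    · rw [eimStep, if_pos hhalt, PMF.toOuterMeasure_pure_apply, if_neg]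
      · exact zero_le
      · simp only [Set.mem_ofPred_eq, not_not]
        exact ⟨hs.1, Or.inl hhalt⟩
    · refine le_trans ((eimStep k ε φ s).toOuterMeasure.mono ?_)
        (eimStep_failure_le hk hε hx hφ hV hhalt hs.1)
      refine fun s' hs' h => hs' ⟨h.1, Or.inr (h.2.trans ?_)⟩
      rw [pow_succ, ← mul_assoc]
      gcongr
      exact hs.2.resolve_left hhalt

theorem OnTrack.halted {V : Type*} [MetricSpace V] [Fintype V] {k : ℕ} {ε : ℝ} (hε : 0 < ε)
    (hn : 0 < Real.log (Fintype.card V)) {t : ℕ} (ht : 2 < ε * t) {s : EIMState V}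
    (hs : OnTrack k ε t s) : Halted k ε s := by
  rcases hs.2 with h | h
  · exact h
  have hN1 : (1 : ℝ) < Fintype.card V := (Real.log_pos_iff (Nat.cast_nonneg _)).1 hn
  -- The bound on |R| is N^(1 - εt/2), with negative exponent, so R is empty.
  have hlt : (s.R.card : ℝ) < 1 := by
    refine h.trans_lt ?_
    have hN0 : (0 : ℝ) < Fintype.card V := by linarith
    rw [← Real.rpow_natCast, ← Real.rpow_mul hN0.le, ← Real.rpow_one_add' hN0.le]
    · exact Real.rpow_lt_one_of_one_lt_of_neg hN1 (by linarith)
    · linarith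
  have h0 : s.R.card = 0 := by
    have : s.R.card < 1 := by exact_mod_cast hlt
    omega
  rw [Halted, h0, Nat.cast_zero]
  positivity

theorem one_sub_le_eimProb {V : Type*} [MetricSpace V] [Fintype V] [DecidableEq V] [Nonempty V]
    {k : ℕ} (hk : 1 ≤ k) {ε φ x : ℝ} (hε : 0 < ε) (hx : 1 ≤ x) (hφ : 3 * x ≤ φ)
    (hV : LargeSpace ε φ (Fintype.card V)) {t : ℕ} (ht : 2 < ε * t) :
    1 - t * (3 * ENNReal.ofReal ((Fintype.card V : ℝ) ^ (-x)))
      ≤ eimProb V k ε φ {C | optFrom k C ≤ 5 * optCost V k} := by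
  refine le_trans ?_ (le_iSup (fun t => (eimRun V k ε φ t).toOuterMeasure
    {s | Halted k ε s ∧ s.S ∪ s.R ∈ {C | optFrom k C ≤ 5 * optCost V k}}) t)
  have hsub : {s : EIMState V | OnTrack k ε t s} ⊆ {s | Halted k ε s ∧
      s.S ∪ s.R ∈ {C | optFrom k C ≤ 5 * optCost V k}} := fun s hs =>
    ⟨OnTrack.halted hε hV.log_pos ht hs, CoveredWithin.optFrom_le hk hs.1⟩
  refine le_trans ?_ ((eimRun V k ε φ t).toOuterMeasure.mono hsub)
  rw [tsub_le_iff_right]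
  have huniv : (eimRun V k ε φ t).toOuterMeasure Set.univ = 1 := by
    rw [PMF.toOuterMeasure_apply_eq_one_iff]
    exact Set.subset_univ _
  rw [← huniv, ← Set.union_compl_self {s : EIMState V | OnTrack k ε t s}]
  exact (MeasureTheory.measure_union_le _ _).trans
    (add_le_add_right (eimRun_failure_le hk hε hx hφ hV t) _)

/-! ### The parameters -/

/-- Let u be the smaller root. Replacing the larger by u gives 6u ≤ 4φ + 3x/2, that is, 2u² - 6ux +
x² ≥ 0. If φ < 3x, then x/2 < u < 5x/2, where this quadratic is negative. -/
theorem three_mul_le_of_quantile_ratio {φ x : ℝ} (hφ : 0 < φ) (hx : 0 < x)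
    (h : (φ + x + √(2 * x * φ + x ^ 2)) / 5 ≤ φ + x / 2 - √(2 * x * φ + x ^ 2 / 4)) :
    3 * x ≤ φ := by
  have hle : √(2 * x * φ + x ^ 2 / 4) ≤ √(2 * x * φ + x ^ 2) :=
    Real.sqrt_le_sqrt (by nlinarith [sq_nonneg x])
  have hsq : √(2 * x * φ + x ^ 2 / 4) ^ 2 = 2 * x * φ + x ^ 2 / 4 :=
    Real.sq_sqrt (by positivity)
  have hlow : x / 2 < √(2 * x * φ + x ^ 2 / 4) :=
    Real.lt_sqrt_of_sq_lt (by nlinarith [mul_pos hx hφ])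
  set u := √(2 * x * φ + x ^ 2 / 4)
  by_contra! hlt
  have hup : u < 5 / 2 * x := by nlinarith [mul_lt_mul_of_pos_left hlt hx]
  have h6 : 6 * u ≤ 4 * φ + 3 / 2 * x := by linarith
  nlinarith [mul_pos (sub_pos.2 hlow) (sub_pos.2 hup), mul_le_mul_of_nonneg_left h6 hx.le,
    mul_pos hx hx]

theorem eventually_largeSpace {ε : ℝ} (hε : 0 < ε) (φ : ℝ) :
    ∀ᶠ N in Filter.atTop, LargeSpace ε φ N := by
  have hlog := Real.tendsto_log_atTop
  have hpow : Filter.Tendsto (fun N : ℝ => N ^ (ε / 2)) Filter.atTop Filter.atTop :=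
    tendsto_rpow_atTop (by positivity)
  have hprod : Filter.Tendsto (fun N : ℝ => 4 / ε * N ^ (ε / 2) * Real.log N) Filter.atTop
      Filter.atTop := (hpow.const_mul_atTop (by positivity)).atTop_mul_atTop₀ hlog
  filter_upwards [hlog.eventually_gt_atTop 0, hlog.eventually_ge_atTop (ε / 4),
    hpow.eventually_ge_atTop (2 * φ), hprod.eventually_ge_atTop 1] with N h1 h2 h3 h4
  exact ⟨h1, h2, h3, h4⟩

theorem mainTheorem4 (ε φ : ℝ) (hε : 0 < ε) (hφ : 0 < φ) :
    ∃ K : ℝ, ∀ γ : ℝ, 0 < γ →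
      (φ + (1 + γ) + √(2 * (1 + γ) * φ + (1 + γ) ^ 2)) / 5
          ≤ φ + (1 + γ) / 2 - √(2 * (1 + γ) * φ + (1 + γ) ^ 2 / 4) →
      ∀ (V : Type*) [MetricSpace V] [Fintype V] [DecidableEq V] [Nonempty V] (k : ℕ), 1 ≤ k →
        ENNReal.ofReal (1 - K * (Fintype.card V : ℝ) ^ (-(1 + γ)))
          ≤ eimProb V k ε φ {C | optFrom k C ≤ 5 * optCost V k} := by
  obtain ⟨M, hM⟩ := Filter.eventually_atTop.1 (eventually_largeSpace hε φ)
  obtain ⟨t, ht⟩ := exists_nat_gt (2 / ε)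
  rw [div_lt_iff₀' hε] at ht
  -- The first entry serves spaces with at least M points. For smaller ones the second makes the
  -- claimed probability nonpositive: N^(1+γ) ≤ M^φ because 1 + γ ≤ φ, so K does not depend on γ.
  refine ⟨max ((t : ℝ) * 3) (M ^ φ), fun γ hγ hcond V _ _ _ _ k hk => ?_⟩
  have h3 := three_mul_le_of_quantile_ratio hφ (by linarith : 0 < 1 + γ) hcond
  have hN1 : (1 : ℝ) ≤ Fintype.card V := by exact_mod_cast Fintype.card_pos (α := V)
  have hN0 : (0 : ℝ) < Fintype.card V := by linarith
  have hpow : 0 < (Fintype.card V : ℝ) ^ (-(1 + γ)) := Real.rpow_pos_of_pos hN0 _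
  by_cases hV : M ≤ Fintype.card V
  · refine le_trans ?_ (one_sub_le_eimProb hk hε (by linarith) h3 (hM _ hV) ht)
    calc ENNReal.ofReal (1 - max ((t : ℝ) * 3) (M ^ φ) * (Fintype.card V : ℝ) ^ (-(1 + γ)))
        ≤ ENNReal.ofReal (1 - t * 3 * (Fintype.card V : ℝ) ^ (-(1 + γ))) := by
          refine ENNReal.ofReal_le_ofReal ?_
          gcongr
          exact le_max_left _ _
      _ = _ := by
          rw [ENNReal.ofReal_sub _ (by positivity), ENNReal.ofReal_one,
            ENNReal.ofReal_mul (by positivity), ENNReal.ofReal_mul (by positivity),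
            ENNReal.ofReal_natCast, mul_assoc, ENNReal.ofReal_ofNat]
  · push Not at hV
    rw [ENNReal.ofReal_of_nonpos]
    · exact zero_le
    have h1 : (Fintype.card V : ℝ) ^ (1 + γ) ≤ M ^ φ :=
      (Real.rpow_le_rpow_of_exponent_le hN1 (by linarith)).trans
        (Real.rpow_le_rpow hN0.le hV.le hφ.le)
    have h2 : (Fintype.card V : ℝ) ^ (1 + γ) * (Fintype.card V : ℝ) ^ (-(1 + γ)) = 1 := by
      rw [← Real.rpow_add hN0, add_neg_cancel, Real.rpow_zero]
    have h4 := mul_le_mul_of_nonneg_right (h1.trans (le_max_right (t * 3 : ℝ) _)) hpow.le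
    linarith
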